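/- Let $A$ and $B$ be finite sets of circles, not both empty. A cobordism from $A$ to $B$ is an abstract compact orientable surface whose boundary circles are labelled bijectively by $A\sqcup B$, up to homeomorphisms that preserve every boundary circle. Such a class is a union $\Sigma_{g_1}(\alpha_1)\cdots\Sigma_{g_k}(\alpha_k)$ of finitely many connected components, given by their genera $g_i\ge 0$ and by their sets of boundary circles $\alpha_i$, which partition $A\sqcup B$ (closed components, with $\alpha_i=\emptyset$, are allowed). Let $\mathrm{Mor}(A,B)$ be the quotient of the group of formal $\mathbb{Z}$-linear combinations of cobordisms from $A$ to $B$ by the local relations * S: a cobordism with a sphere component is $0$; * T: a torus component may be removed and replaced by the factor $2$; * 4TU: $C_{12}+C_{34}=C_{13}+C_{24}$ for every cobordism $C$ and all disjoint discs $D_1,\dots,D_4$ in $C$ (several of which may lie on one component), where $C_{ij}$ is the result of removing $D_i$ and $D_j$ from $C$ and replacing them by a tube with the same boundary, in such a way that the surface stays orientable. Thus $\mathrm{Mor}(A,B)$ is a morphism group of the category $\mathcal{C}ob_{/l}$ with at least one boundary circle. Fix a special boundary circle $s\in A\sqcup B$. The component of a cobordism that contains $s$ is called special, the other components non-special. Adding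 a handle to the special component respects the local relations, so it defines an endomorphism $H$ of $\mathrm{Mor}(A,B)$, and $\mathrm{Mor}(A,B)$ is a module over the polynomial ring $\mathbb{Z}[H]$. Then $\mathrm{Mor}(A,B)$ is a free $\mathbb{Z}[H]$-module. A basis is given by the classes of the cobordisms whose special component has genus $0$ (with any number of boundary circles) and whose non-special components all have genus $0$ and exactly one boundary circle; different cobordisms of this form are different basis elements. -/

import Mathlib

open Polynomial

noncomputable section

namespace CobL

universe u v

/-- A compact orientable abstract surface whose boundary circles are labelled by `S`, presented by
its finite set of connected components, the genus of every component, and the map that sends a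
boundary circle to the component it lies on. Components without boundary circles are closed. The
union `Σ_{g₁}(α₁, …) Σ_{g₂}(β₁, …) ⋯` has components `1, 2, …`, of genera `g₁, g₂, …`, and the
circles that are sent to component `1` are `α₁, …`, and so on. -/
structure Surface (S : Type u) where
  /-- the set of connected components -/
  components : Type
  [fintype : Fintype components]
  /-- the genus of a component -/
  genus : components → ℕ
  /-- the component that contains a given boundary circle -/
  comp : S → components

attribute [instance] Surface.fintype

namespace Surface

variable {S : Type u}

/-- Two surfaces are homeomorphic by a homeomorphism that preserves every boundary circle: there is
a bijection of the components which preserves the genus and the boundary circles. -/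
def Homeo (C D : Surface S) : Prop :=
  ∃ e : C.components ≃ D.components,
    (∀ i, D.genus (e i) = C.genus i) ∧ ∀ c, D.comp c = e (C.comp c)

theorem homeo_equivalence : Equivalence (Homeo (S := S)) where
  refl C := ⟨Equiv.refl _, fun _ => rfl, fun _ => rfl⟩
  symm := by
    rintro C D ⟨e, hg, hc⟩
    refine ⟨e.symm, fun i => ?_, fun c => ?_⟩
    · rw [← hg, e.apply_symm_apply]
    · rw [hc, e.symm_apply_apply]
  trans := by
    rintro C D E ⟨e, hg, hc⟩ ⟨f, hg', hc'⟩
    refine ⟨e.trans f, fun i => ?_, fun c => ?_⟩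
    · rw [Equiv.trans_apply, hg', hg]
    · rw [hc', hc, Equiv.trans_apply]

instance setoid (S : Type u) : Setoid (Surface S) := ⟨Homeo, homeo_equivalence⟩

open Classical in
/-- Adding a handle to the component that contains the boundary circle `s`. -/
def addHandle (s : S) (C : Surface S) : Surface S where
  components := C.components
  genus i := C.genus i + if i = C.comp s then 1 else 0
  comp := C.comp

/-- Disjoint union with a closed connected surface of genus `g`. -/
def addClosed (g : ℕ) (C : Surface S) : Surface S where
  components := Option C.components
  genus
    | none => g
    | some i => C.genus i
  comp c := some (C.comp c)

open Classical in
/-- The result of removing two disjoint discs, one in component `i` and one in component `j`, and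
replacing them by a tube with the same boundary. If `i ≠ j`, the two components become one
component, which carries the boundary circles of both, and the genera add up; if `i = j`, the genus
of that component goes up by one. All other components are unchanged. -/
def tube (C : Surface S) (i j : C.components) : Surface S where
  components := Quot fun a b : C.components => a = i ∧ b = j
  fintype := Fintype.ofFinite _
  genus q := (∑ a : C.components, if Quot.mk _ a = q then C.genus a else 0) +
    if i = j ∧ Quot.mk _ i = q then 1 else 0
  comp c := Quot.mk _ (C.comp c)

/-- The special component, the one that contains the special circle `s`, has genus zero (and any
boundary circles besides `s`); every other component has genus zero and exactly one boundary
circle. -/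
def IsGenerator (s : S) (C : Surface S) : Prop :=
  C.genus (C.comp s) = 0 ∧
    ∀ i, i ≠ C.comp s → C.genus i = 0 ∧ ∃! c : S, C.comp c = i

theorem isGenerator_of_homeo (s : S) {C D : Surface S} (h : Homeo C D) (hC : C.IsGenerator s) :
    D.IsGenerator s := by
  obtain ⟨e, hg, hc⟩ := h
  refine ⟨by rw [hc, hg, hC.1], fun i hi => ?_⟩
  obtain ⟨j, rfl⟩ := e.surjective i
  have hj : j ≠ C.comp s := fun h => hi (by rw [hc, h])
  obtain ⟨h0, c, h1, h2⟩ := hC.2 j hj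
  refine ⟨by rw [hg, h0], c, by simp only [hc, h1], fun c' h' => h2 c' ?_⟩
  simpa only [hc, e.apply_eq_iff_eq] using h'

theorem addHandle_congr (s : S) {C D : Surface S} (h : Homeo C D) :
    Homeo (C.addHandle s) (D.addHandle s) := by
  classical
  obtain ⟨e, hg, hc⟩ := h
  exact ⟨e, fun i => congrArg₂ (· + ·) (hg i) (if_congr (by
    rw [hc]; exact e.apply_eq_iff_eq) rfl rfl), hc⟩

theorem addHandle_addClosed (s : S) (g : ℕ) (C : Surface S) :
    Homeo ((C.addClosed g).addHandle s) ((C.addHandle s).addClosed g) := by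
  refine ⟨Equiv.refl _, ?_, fun _ => rfl⟩
  rintro (_ | i)
  · exact (Nat.add_eq_left.2 (@if_neg _ (Classical.propDecidable _)
      (Option.some_ne_none (C.comp s)).symm _ _ _)).symm
  · have h : (some i = some (C.comp s)) = (i = C.comp s) := Option.some.injEq _ _
    have h' : ∀ p q : Prop, p = q → @ite ℕ q (Classical.propDecidable _) 1 0 =
        @ite ℕ p (Classical.propDecidable _) 1 0 := by
      rintro p _ rfl
      rfl
    exact congrArg (C.genus i + ·) (h' _ _ h)

theorem addHandle_tube (s : S) (C : Surface S) (i j : C.components) :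
    Homeo ((C.tube i j).addHandle s) ((C.addHandle s).tube i j) := by
  classical
  refine ⟨Equiv.refl _, fun q => ?_, fun _ => rfl⟩
  revert q
  change ∀ q : Quot fun a b : C.components => a = i ∧ b = j,
    (∑ a : C.components, if Quot.mk _ a = q then
      C.genus a + (if a = C.comp s then 1 else 0) else 0) + _ =
    (∑ a : C.components, if Quot.mk _ a = q then C.genus a else 0) + _ +
      if q = Quot.mk _ (C.comp s) then 1 else 0
  intro q
  have key : ∀ a : C.components, (if Quot.mk (fun a b => a = i ∧ b = j) a = q then
      C.genus a + (if a = C.comp s then 1 else 0) else 0) =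
      (if Quot.mk (fun a b => a = i ∧ b = j) a = q then C.genus a else 0) +
      if a = C.comp s then (if q = Quot.mk (fun a b => a = i ∧ b = j) (C.comp s)
        then 1 else 0) else 0 := by
    intro a
    by_cases ha : a = C.comp s
    · subst ha
      by_cases hq : q = Quot.mk (fun a b => a = i ∧ b = j) (C.comp s)
      · simp only [hq, if_true]
      · simp only [hq, Ne.symm hq, if_true, if_false]
    · simp only [ha, if_false, add_zero]
  rw [Finset.sum_congr rfl fun a _ => key a, Finset.sum_add_distrib, Finset.sum_ite_eq']
  simp only [Finset.mem_univ, if_true]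
  exact add_right_comm _ _ _

end Surface

/-- Cobordisms from the circles `A` to the circles `B`: surfaces with boundary circles `A ⊔ B`, up
to homeomorphisms that preserve the boundary circles. -/
def Cob (A : Type u) (B : Type v) : Type (max 1 u v) := Quotient (Surface.setoid (A ⊕ B))

/-- The cobordism given by a surface. -/
def Cob.mk {A : Type u} {B : Type v} (C : Surface (A ⊕ B)) : Cob A B :=
  Quotient.mk _ C

/-- The cobordisms whose special component (the one that contains `s`) has genus zero and whose
other components are discs, that is, have genus zero and exactly one boundary circle. -/
def Cob.IsGenerator {A : Type u} {B : Type v} (s : A ⊕ B) : Cob A B → Prop :=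
  Quotient.lift (Surface.IsGenerator s) fun _ _ h =>
    propext ⟨Surface.isGenerator_of_homeo s h,
      Surface.isGenerator_of_homeo s (Surface.homeo_equivalence.symm h)⟩

/-- Adding a handle to the component that contains the boundary circle `s`. -/
def Cob.addHandle {A : Type u} {B : Type v} (s : A ⊕ B) : Cob A B → Cob A B :=
  Quotient.map (Surface.addHandle s) fun _ _ h => Surface.addHandle_congr s h

/-- A cobordism as an element of the group of formal `ℤ`-linear combinations of cobordisms. -/
def single {A : Type u} {B : Type v} (C : Surface (A ⊕ B)) : Cob A B →₀ ℤ :=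
  Finsupp.single (Cob.mk C) 1

/-- The local relations `S`, `T` and `4TU`. In the last one, `d k` is the component of `C` on which
the disc `D_{k+1}` lies, for `k = 0, 1, 2, 3`; several discs may lie on one component. -/
inductive IsRelation (A : Type u) (B : Type v) : (Cob A B →₀ ℤ) → Prop
  | sphere (C : Surface (A ⊕ B)) : IsRelation A B (single (C.addClosed 0))
  | torus (C : Surface (A ⊕ B)) : IsRelation A B (single (C.addClosed 1) - 2 • single C)
  | fourTube (C : Surface (A ⊕ B)) (d : Fin 4 → C.components) : IsRelation A B
      (single (C.tube (d 0) (d 1)) + single (C.tube (d 2) (d 3))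
        - single (C.tube (d 0) (d 2)) - single (C.tube (d 1) (d 3)))

/-- The subgroup generated by the local relations. -/
def relations (A : Type u) (B : Type v) : Submodule ℤ (Cob A B →₀ ℤ) :=
  Submodule.span ℤ {x | IsRelation A B x}

/-- The morphism group from the circles `A` to the circles `B` of the category of cobordisms modulo
the local relations `S`, `T` and `4TU`. -/
abbrev Mor (A : Type u) (B : Type v) : Type (max 1 u v) := (Cob A B →₀ ℤ) ⧸ relations A B

/-- The class of a cobordism in the morphism group. -/
def Mor.of {A : Type u} {B : Type v} (x : Cob A B) : Mor A B :=
  (relations A B).mkQ (Finsupp.single x 1)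

/-- The linear extension of `Cob.addHandle` to formal linear combinations. -/
def handleLin {A : Type u} {B : Type v} (s : A ⊕ B) : (Cob A B →₀ ℤ) →ₗ[ℤ] (Cob A B →₀ ℤ) :=
  Finsupp.lmapDomain ℤ ℤ (Cob.addHandle s)

theorem handleLin_single {A : Type u} {B : Type v} (s : A ⊕ B) (C : Surface (A ⊕ B)) :
    handleLin s (single C) = single (C.addHandle s) := by
  simp only [handleLin, single, Finsupp.lmapDomain_apply, Finsupp.mapDomain_single]
  rfl

theorem single_eq {A : Type u} {B : Type v} {C D : Surface (A ⊕ B)} (h : C.Homeo D) :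
    single C = single D := by
  unfold single
  rw [show Cob.mk C = Cob.mk D from Quotient.sound h]

theorem relations_le_comap {A : Type u} {B : Type v} (s : A ⊕ B) :
    relations A B ≤ (relations A B).comap (handleLin s) := by
  refine Submodule.span_le.2 fun x hx => ?_
  refine Submodule.subset_span (s := {x | IsRelation A B x}) ?_
  rcases hx with C | C | ⟨C, d⟩
  · rw [handleLin_single, single_eq (C.addHandle_addClosed s 0)]
    exact .sphere _
  · rw [map_sub, map_nsmul, handleLin_single, handleLin_single,
      single_eq (C.addHandle_addClosed s 1)]
    exact .torus _
  · simp only [map_sub, map_add, handleLin_single]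
    rw [single_eq (C.addHandle_tube s _ _), single_eq (C.addHandle_tube s _ _),
      single_eq (C.addHandle_tube s _ _), single_eq (C.addHandle_tube s _ _)]
    exact .fourTube (C.addHandle s) d

/-- The special 1-handle operator `H` on the morphism group. -/
def H {A : Type u} {B : Type v} (s : A ⊕ B) : Mor A B →ₗ[ℤ] Mor A B :=
  (relations A B).mapQ (relations A B) (handleLin s) (relations_le_comap s)

/-- The morphism group as a module over `ℤ[H]`: the polynomial variable acts as the special
1-handle operator. -/
abbrev MorH {A : Type u} {B : Type v} (s : A ⊕ B) : Type (max 1 u v) := Module.AEval' (H s)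

/-- The class of a cobordism in the morphism group, seen as a module over `ℤ[H]`. -/
def MorH.of {A : Type u} {B : Type v} (s : A ⊕ B) (x : Cob A B) : MorH s :=
  Module.AEval'.of (H s) (Mor.of x)

end CobL

end

/-! Spanning. Put two of the four discs of 4TU on the special component and the others on components
`i` and `j`. This rewrites a tube from `i` to `j` as the sum of the tubes from the special component
to `i` and to `j`, minus `H` applied to the surface without a tube (`MorH.of_tube`). Any handle on a
non-special component, and any boundary circle there beyond the first, can be exhibited through such
a tube. Cutting it lowers the total excess of the non-special components, and handles on the special
component are powers of `H`. At excess zero only generators and surfaces with a sphere component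
remain (`MorH.of_mem_of_generators_mem`).

Independence. Over the fraction field of `ℤ[X]`, with `h = X`, take the two-state semisimple field
theory whose handle eigenvalues are `h` and `-h`. Its state sum respects S, T and 4TU for arbitrary
values `z` on the boundary circles (`relations_le_ker_stateSum`). If `z` forbids the state `false`
at `s`, then `H` acts as multiplication by `h`, so the state sum is `ℤ[H]`-linear. A generator is
determined by the set `P` of circles on its special component, and `detector` chooses `z` so that
the state sum, multiplied by `h`, is 1 on the generator of `P` and 0 on all others: a dual family.
-/

noncomputable section

namespace CobL

universe u v

/-! ### Tubes within one component and between two components. -/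

namespace Surface

variable {S : Type u}

open Classical in
/-- A surjection on components that identifies exactly `i` and `j`, and that is compatible with
genera and boundary circles, exhibits its target as the result of a tube between `i` and `j`. -/
theorem tube_homeo_of_surjective (C D : Surface S) (i j : C.components)
    (f : C.components → D.components) (hf : Function.Surjective f) (hij : f i = f j)
    (hker : ∀ a b, f a = f b → a = b ∨ (a = i ∧ b = j) ∨ (a = j ∧ b = i))
    (hg : ∀ q, D.genus q =
      (∑ a, if f a = q then C.genus a else 0) + if i = j ∧ f i = q then 1 else 0)
    (hc : ∀ c, D.comp c = f (C.comp c)) : (C.tube i j).Homeo D := by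
  let F : (C.tube i j).components → D.components :=
    Quot.lift f (by rintro a b ⟨rfl, rfl⟩; exact hij)
  have hF : Function.Bijective F := by
    refine ⟨?_, fun q => ?_⟩
    · rintro ⟨a⟩ ⟨b⟩ h
      rcases hker a b h with rfl | ⟨rfl, rfl⟩ | ⟨rfl, rfl⟩
      · rfl
      · exact Quot.sound ⟨rfl, rfl⟩
      · exact (Quot.sound ⟨rfl, rfl⟩).symm
    · obtain ⟨a, rfl⟩ := hf q
      exact ⟨Quot.mk _ a, rfl⟩
  refine ⟨Equiv.ofBijective F hF, fun q => ?_, fun c => hc c⟩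
  have key : ∀ a : C.components, f a = F q ↔ Quot.mk _ a = q := fun a =>
    hF.1.eq_iff (a := Quot.mk _ a)
  change D.genus (F q) = (∑ a : C.components, if Quot.mk _ a = q then C.genus a else 0) +
    if i = j ∧ Quot.mk _ i = q then 1 else 0
  rw [hg]
  simp only [key]

open Classical in
/-- Adding a handle to the component `i`. -/
abbrev handleAt (C : Surface S) (i : C.components) : Surface S where
  components := C.components
  genus a := C.genus a + if a = i then 1 else 0
  comp := C.comp

open Classical in
/-- Merging the component `j` into a different component `i`. -/
abbrev merge (C : Surface S) (i j : C.components) (h : i ≠ j) : Surface S where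
  components := {a : C.components // a ≠ j}
  fintype := Subtype.fintype (· ≠ j)
  genus a := C.genus a + if a.1 = i then C.genus j else 0
  comp c := if hc : C.comp c = j then ⟨i, h⟩ else ⟨C.comp c, hc⟩

theorem tube_self (C : Surface S) (i : C.components) : (C.tube i i).Homeo (C.handleAt i) := by
  classical
  refine tube_homeo_of_surjective C (C.handleAt i) i i id Function.surjective_id rfl
    (fun a b h => .inl h) (fun q => ?_) fun _ => rfl
  change (C.genus q + if q = i then 1 else 0) =
    (∑ a : C.components, if a = q then C.genus a else 0) + if i = i ∧ i = q then 1 else 0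
  rw [Finset.sum_ite_eq' Finset.univ q, if_pos (Finset.mem_univ q)]
  simp only [true_and, eq_comm]

theorem tube_ne (C : Surface S) {i j : C.components} (h : i ≠ j) :
    (C.tube i j).Homeo (C.merge i j h) := by
  classical
  refine tube_homeo_of_surjective C (C.merge i j h) i j
    (fun a => if ha : a = j then ⟨i, h⟩ else ⟨a, ha⟩) (fun q => ⟨q.1, ?_⟩) ?_ (fun a b hab => ?_)
    (fun q => ?_) fun _ => rfl
  · exact dif_neg q.2
  · simp only [h, dite_true, dite_false]
  · dsimp only at hab
    split_ifs at hab with h1 h2 h2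
    · exact .inl (h1.trans h2.symm)
    · exact .inr (.inr ⟨h1, (Subtype.ext_iff.1 hab).symm⟩)
    · exact .inr (.inl ⟨Subtype.ext_iff.1 hab, h2⟩)
    · exact .inl (Subtype.ext_iff.1 hab)
  · obtain ⟨q, hq⟩ := q
    trans ∑ a, ((if a = q then C.genus a else 0) +
      if a = j then if q = i then C.genus j else 0 else 0)
    · rw [Finset.sum_add_distrib, Finset.sum_ite_eq', Finset.sum_ite_eq']
      simp only [Finset.mem_univ, if_true]
    · simp only [h, false_and, if_false, add_zero]
      refine Finset.sum_congr rfl fun a _ => ?_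
      by_cases ha : a = j
      · subst ha
        simp only [dite_true, Subtype.mk.injEq, if_true, Ne.symm hq, if_false, zero_add, eq_comm]
      · simp only [ha, dite_false, Subtype.mk.injEq, if_false, add_zero]

/-! ### The two-state topological field theory. -/

section StateSum

variable {K : Type*} [Field K] [Fintype S] (h : K) (z : S → Bool → K)

/-- The value of a handle on a component in a given state. -/
def handleValue : Bool → K
  | true => h
  | false => -h

variable {h} in
theorem handleValue_ne_zero (hh : h ≠ 0) (b : Bool) : handleValue h b ≠ 0 := by
  cases b
  · exact neg_ne_zero.2 hh
  · exact hh

/-- The weight of a state, that is, of an assignment of one of two states to every component. -/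
def stateWeight (C : Surface S) (σ : C.components → Bool) : K :=
  (∏ i, handleValue h (σ i) ^ C.genus i * (handleValue h (σ i))⁻¹) * ∏ c, z c (σ (C.comp c))

open Classical in
/-- The semisimple two-dimensional topological field theory given by two states. -/
def stateSum (C : Surface S) : K := ∑ σ, C.stateWeight h z σ

theorem stateSum_eq_of_homeo {C D : Surface S} (hCD : C.Homeo D) :
    C.stateSum h z = D.stateSum h z := by
  obtain ⟨e, hg, hc⟩ := hCD
  classical
  refine (Fintype.sum_equiv (Equiv.arrowCongr e.symm (Equiv.refl Bool)) _ _ fun σ => ?_).symm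
  simp only [stateWeight, hc]
  rw [← Equiv.prod_comp e]
  simp only [hg]
  rfl

-- States of different components are independent, so the sum over states factors over components.
open Classical in
theorem stateSum_eq_prod (C : Surface S) :
    C.stateSum h z = ∏ i, ∑ b, handleValue h b ^ C.genus i * (handleValue h b)⁻¹ *
      ∏ c with C.comp c = i, z c b := by
  rw [Finset.prod_univ_sum, stateSum, Fintype.piFinset_univ]
  refine Finset.sum_congr rfl fun σ _ => ?_
  rw [Finset.prod_mul_distrib, stateWeight]
  congr 1
  rw [← Finset.prod_fiberwise Finset.univ C.comp]
  refine Finset.prod_congr rfl fun i _ => Finset.prod_congr rfl fun c hc => ?_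
  rw [(Finset.mem_filter.1 hc).2]

theorem stateSum_addClosed (C : Surface S) (g : ℕ) :
    (C.addClosed g).stateSum h z = (h ^ g * h⁻¹ + (-h) ^ g * (-h)⁻¹) * C.stateSum h z := by
  classical
  rw [stateSum_eq_prod, stateSum_eq_prod]
  refine (Fintype.prod_option _).trans ?_
  congr 1
  · simp [addClosed, handleValue]
  · simp [addClosed]

theorem stateWeight_handleAt (C : Surface S) (i : C.components) (σ : C.components → Bool) :
    (C.handleAt i).stateWeight h z σ = C.stateWeight h z σ * handleValue h (σ i) := by
  classical
  have hp : ∏ a : C.components, handleValue h (σ a) ^ (if a = i then 1 else 0) =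
      handleValue h (σ i) := by
    simp only [pow_ite, pow_one, pow_zero, Finset.prod_ite_eq', Finset.mem_univ, if_true]
  rw [stateWeight, stateWeight, mul_right_comm, ← hp, ← Finset.prod_mul_distrib]
  congr 1
  refine Finset.prod_congr rfl fun a _ => ?_
  rw [pow_add]
  ring

-- A component of genus `g` in a state with handle value `v` has weight `v ^ (g - 1)`. Merging adds
-- genera but leaves one factor `v⁻¹` instead of two, which costs a factor `v`, just as a new handle
-- does.
variable {h} in
theorem stateWeight_merge (hh : h ≠ 0) (C : Surface S) {i j : C.components} (hij : i ≠ j)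
    (τ : C.components → Bool) (hτ : τ i = τ j) :
    (C.merge i j hij).stateWeight h z (fun a => τ a.1) =
      C.stateWeight h z τ * handleValue h (τ i) := by
  classical
  have h0 := handleValue_ne_zero hh
  have hc : ∀ c, τ ((C.merge i j hij).comp c).1 = τ (C.comp c) := by
    intro c
    by_cases h1 : C.comp c = j
    · simp only [h1, dite_true, hτ]
    · simp only [h1, dite_false]
  have hp : ∏ a : {a // a ≠ j}, handleValue h (τ a) ^ (if a.1 = i then C.genus j else 0) =
      handleValue h (τ i) ^ C.genus j := by
    rw [Finset.prod_eq_single (⟨i, hij⟩ : {a // a ≠ j})]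
    · simp
    · rintro ⟨b, hb⟩ - hb'
      have : b ≠ i := fun hbi => hb' (Subtype.ext hbi)
      simp [this]
    · simp
  have : ∏ a : (C.merge i j hij).components, handleValue h (τ a.1) ^ (C.merge i j hij).genus a *
      (handleValue h (τ a.1))⁻¹ = (∏ a : {a // a ≠ j}, handleValue h (τ a) ^ C.genus a *
      (handleValue h (τ a))⁻¹) * handleValue h (τ i) ^ C.genus j := by
    rw [← hp, ← Finset.prod_mul_distrib]
    refine Finset.prod_congr (Finset.ext fun _ => by simp only [Finset.mem_univ]) fun a _ => ?_
    rw [pow_add]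
    ring
  change (∏ a : (C.merge i j hij).components, handleValue h (τ a.1) ^ (C.merge i j hij).genus a *
    (handleValue h (τ a.1))⁻¹) * ∏ c, z c (τ ((C.merge i j hij).comp c).1) = _
  rw [this, Finset.prod_congr rfl fun c _ => congrArg (z c) (hc c), stateWeight,
    Fintype.prod_eq_mul_prod_subtype_ne _ j, ← hτ]
  field_simp [h0 (τ i)]

variable {h} in
open Classical in
theorem stateSum_tube (hh : h ≠ 0) (C : Surface S) (i j : C.components) :
    (C.tube i j).stateSum h z =
      ∑ σ, C.stateWeight h z σ * if σ i = σ j then handleValue h (σ i) else 0 := by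
  by_cases hij : i = j
  · subst hij
    rw [stateSum_eq_of_homeo h z (C.tube_self i), stateSum]
    simp only [stateWeight_handleAt, if_true]
  · rw [stateSum_eq_of_homeo h z (C.tube_ne hij)]
    -- States of the merged surface correspond to the states of `C` that agree on `i` and `j`; all
    -- others contribute zero.
    let E : ({a : C.components // a ≠ j} → Bool) → C.components → Bool :=
      fun τ a => if ha : a = j then τ ⟨i, hij⟩ else τ ⟨a, ha⟩
    have hE : ∀ τ a, E τ a.1 = τ a := fun τ a => dif_neg a.2
    have hEi : ∀ τ, E τ i = τ ⟨i, hij⟩ := fun τ => hE τ ⟨i, hij⟩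
    have hEj : ∀ τ, E τ j = τ ⟨i, hij⟩ := fun τ => dif_pos rfl
    have key := Fintype.sum_of_injective E (fun τ τ' e => funext fun a => ?_)
      ((C.merge i j hij).stateWeight h z)
      (fun σ => C.stateWeight h z σ * if σ i = σ j then handleValue h (σ i) else 0)
      (fun σ hσ => ?_) fun τ => ?_
    · rw [stateSum, ← key]
      exact Finset.sum_congr (Finset.ext fun _ => by simp only [Finset.mem_univ]) fun _ _ => rfl
    · exact (hE τ a).symm.trans ((congrFun e _).trans (hE τ' a))
    · by_cases hs : σ i = σ j
      · refine absurd ⟨fun a : {a : C.components // a ≠ j} => σ a.1, funext fun a => ?_⟩ hσ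
        by_cases ha : a = j
        · exact (congrArg _ ha).trans ((hEj fun a => σ a.1).trans (hs.trans (congrArg σ ha.symm)))
        · exact hE (fun a => σ a.1) ⟨a, ha⟩
      · simp only [if_neg hs, mul_zero]
    · rw [if_pos ((hEi τ).trans (hEj τ).symm),
        ← stateWeight_merge z hh C hij (E τ) ((hEi τ).trans (hEj τ).symm)]
      exact congrArg _ (funext fun a => (hE τ a).symm)

-- The factor of a tube between states `a` and `b` is `h * ([a = true] + [b = true] - 1)`. Being a
-- sum of separate contributions of its two ends, it satisfies 4TU state by state.
variable {h} in
theorem stateSum_fourTube (hh : h ≠ 0) (C : Surface S) (d : Fin 4 → C.components) :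
    (C.tube (d 0) (d 1)).stateSum h z + (C.tube (d 2) (d 3)).stateSum h z =
      (C.tube (d 0) (d 2)).stateSum h z + (C.tube (d 1) (d 3)).stateSum h z := by
  simp only [stateSum_tube z hh, ← Finset.sum_add_distrib, ← mul_add]
  refine Finset.sum_congr rfl fun σ _ => congrArg _ ?_
  cases σ (d 0) <;> cases σ (d 1) <;> cases σ (d 2) <;> cases σ (d 3) <;> simp [handleValue]

/-- Only states that are `true` on the special component survive, and there a handle has value `h`.
-/
theorem stateSum_addHandle (C : Surface S) (s : S) (hs : z s false = 0) :
    (C.addHandle s).stateSum h z = h * C.stateSum h z := by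
  change (C.handleAt (C.comp s)).stateSum h z = _
  rw [stateSum, stateSum, Finset.mul_sum]
  refine Finset.sum_congr rfl fun σ _ => ?_
  refine (stateWeight_handleAt h z C (C.comp s) σ).trans ?_
  cases hσ : σ (C.comp s)
  · have : C.stateWeight h z σ = 0 := by
      rw [stateWeight, Finset.prod_eq_zero (Finset.mem_univ s) (by rw [hσ, hs]), mul_zero]
    simp only [this, zero_mul, mul_zero]
  · exact mul_comm _ _

end StateSum

/-! ### Generators and the state sums dual to them. -/

section Generators

/-- The state values of circles that detect the generator in which the circles in `P` lie on the
special component and all other circles bound discs. -/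
def detector {K : Type*} [Field K] (h : K) (s : S) (P : Set S) : S → Bool → K := by
  classical
  exact fun c b => if c ∈ P then if b = true ∨ c ≠ s then 1 else 0 else if b then 0 else -h

/-- The set of boundary circles of the special component. -/
def specialCircles (C : Surface S) (s : S) : Set S := {c | C.comp c = C.comp s}

variable {K : Type*} [Field K] {h : K} {s : S}

theorem mem_specialCircles_self (C : Surface S) : s ∈ C.specialCircles s := rfl

theorem detector_special_false {P : Set S} (hs : s ∈ P) : detector h s P s false = 0 := by
  simp [detector, hs]

/-- All genera vanish and every component meets the boundary, so the partition of the circles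
determines the surface; its blocks are the special one and singletons. -/
theorem IsGenerator.homeo_of_specialCircles_eq {C D : Surface S} (hC : C.IsGenerator s)
    (hD : D.IsGenerator s) (e : C.specialCircles s = D.specialCircles s) : C.Homeo D := by
  have surj : ∀ {C : Surface S}, C.IsGenerator s → Function.Surjective C.comp := by
    intro C hC i
    by_cases hi : i = C.comp s
    · exact ⟨s, hi.symm⟩
    · obtain ⟨c, hc, -⟩ := (hC.2 i hi).2
      exact ⟨c, hc⟩
  have ker : ∀ {C : Surface S}, C.IsGenerator s → ∀ c c', C.comp c = C.comp c' ↔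
      c = c' ∨ (c ∈ C.specialCircles s ∧ c' ∈ C.specialCircles s) := by
    intro C hC c c'
    refine ⟨fun h => ?_, ?_⟩
    · by_cases hi : C.comp c = C.comp s
      · exact .inr ⟨hi, h.symm.trans hi⟩
      · exact .inl ((hC.2 _ hi).2.unique rfl h.symm)
    · rintro (rfl | ⟨h, h'⟩)
      · rfl
      · exact h.trans h'.symm
  have genus : ∀ {C : Surface S}, C.IsGenerator s → ∀ i, C.genus i = 0 := by
    intro C hC i
    by_cases hi : i = C.comp s
    · rw [hi, hC.1]
    · exact (hC.2 i hi).1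
  have key : ∀ c c', C.comp c = C.comp c' ↔ D.comp c = D.comp c' := fun c c' => by
    rw [ker hC, ker hD, e]
  let f : C.components → D.components := fun i => D.comp (Function.surjInv (surj hC) i)
  have hf : ∀ c, f (C.comp c) = D.comp c := fun c =>
    (key _ _).1 (Function.surjInv_eq (surj hC) (C.comp c))
  have hb : Function.Bijective f := by
    refine ⟨fun i j hij => ?_, fun q => ?_⟩
    · obtain ⟨c, rfl⟩ := surj hC i
      obtain ⟨c', rfl⟩ := surj hC j
      rw [hf, hf] at hij
      exact (key _ _).2 hij
    · obtain ⟨c, rfl⟩ := surj hD q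
      exact ⟨_, hf c⟩
  exact ⟨Equiv.ofBijective f hb, fun i => by rw [genus hD, genus hC], fun c => (hf c).symm⟩

variable [Fintype S]

/-- The special component contributes `h⁻¹` from the state `true`, and each disc contributes `(-h)⁻¹
* (-h) = 1` from the state `false`. -/
theorem IsGenerator.stateSum_detector_self {C : Surface S} (hC : C.IsGenerator s) (hh : h ≠ 0) :
    h * C.stateSum h (detector h s (C.specialCircles s)) = 1 := by
  classical
  rw [stateSum_eq_prod, Fintype.prod_eq_mul_prod_subtype_ne _ (C.comp s), Finset.prod_eq_one]
  · rw [Fintype.sum_bool, Finset.prod_eq_one, Finset.prod_eq_zero (i := s)]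
    · simp [hC.1, handleValue, hh]
    · simp
    · exact detector_special_false C.mem_specialCircles_self
    · intro c hc
      have : c ∈ C.specialCircles s := (Finset.mem_filter.1 hc).2
      simp [detector, this]
  · rintro ⟨i, hi⟩ -
    obtain ⟨hg, c, rfl, hc⟩ := hC.2 i hi
    have hfil : ({c' | C.comp c' = C.comp c} : Finset S) = {c} := by
      ext c'
      simp only [Finset.mem_filter, Finset.mem_univ, true_and, Finset.mem_singleton]
      exact ⟨hc c', fun h => by rw [h]⟩
    have hcs : c ∉ C.specialCircles s := hi
    simp only [hfil, Finset.prod_singleton, Fintype.sum_bool, hg]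
    simp [detector, hcs, handleValue, hh]

theorem IsGenerator.stateSum_detector_of_ne {C : Surface S} (hC : C.IsGenerator s) {P : Set S}
    (hs : s ∈ P) (hP : C.specialCircles s ≠ P) :
    C.stateSum h (detector h s P) = 0 := by
  classical
  rw [stateSum_eq_prod]
  obtain ⟨c, hc⟩ : ∃ c, ¬ (c ∈ C.specialCircles s ↔ c ∈ P) := by
    by_contra! H
    exact hP (Set.ext H)
  by_cases h1 : c ∈ C.specialCircles s
  -- On the special component, `c` kills the state `true` and `s` kills the state `false`.
  · have h2 : c ∉ P := fun h2 => hc (iff_of_true h1 h2)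
    refine Finset.prod_eq_zero (Finset.mem_univ (C.comp s)) ?_
    rw [Fintype.sum_bool, Finset.prod_eq_zero (i := c), Finset.prod_eq_zero (i := s)]
    · simp
    · simp
    · exact detector_special_false hs
    · exact Finset.mem_filter.2 ⟨Finset.mem_univ c, h1⟩
    · simp [detector, h2]
  -- Here `c` bounds a disc and has value 1 in both states, so the disc contributes `h⁻¹ + (-h)⁻¹ =
  -- 0`.
  · have h2 : c ∈ P := by
      by_contra h2
      exact hc (iff_of_false h1 h2)
    have hcs : c ≠ s := by
      rintro rfl
      exact h1 C.mem_specialCircles_self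
    refine Finset.prod_eq_zero (Finset.mem_univ (C.comp c)) ?_
    have hi := hC.2 (C.comp c) h1
    have hfil : ({c' | C.comp c' = C.comp c} : Finset S) = {c} := by
      ext c'
      simp only [Finset.mem_filter, Finset.mem_univ, true_and, Finset.mem_singleton]
      exact ⟨fun h => hi.2.unique h rfl, fun h => by rw [h]⟩
    simp only [hfil, Finset.prod_singleton, Fintype.sum_bool, hi.1]
    simp [detector, h2, hcs, handleValue, inv_neg]

end Generators

/-! ### The excess, the complexity for the induction. -/

section Excess

variable [Fintype S]

open Classical in
/-- The genus of a component plus the number of its boundary circles beyond the first one. -/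
def componentExcess (C : Surface S) (i : C.components) : ℕ :=
  C.genus i + (Finset.card {c | C.comp c = i} - 1)

open Classical in
/-- The total excess of the non-special components. -/
def excess (s : S) (C : Surface S) : ℕ :=
  ∑ i, if i = C.comp s then 0 else C.componentExcess i

theorem excess_eq_of_homeo (s : S) {C D : Surface S} (h : C.Homeo D) :
    C.excess s = D.excess s := by
  classical
  obtain ⟨e, hg, hc⟩ := h
  refine Fintype.sum_equiv e _ _ fun i => ?_
  simp only [componentExcess, hg, hc, e.apply_eq_iff_eq]

/-- The special component absorbs `j`, whose contribution disappears; the other non-special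
components are untouched. -/
theorem excess_tube_special_le (s : S) (C : Surface S) {j : C.components} (hj : j ≠ C.comp s) :
    (C.tube (C.comp s) j).excess s ≤ C.excess s := by
  classical
  rw [excess_eq_of_homeo s (C.tube_ne hj.symm)]
  have hs : ((C.merge (C.comp s) j hj.symm).comp s) = ⟨C.comp s, hj.symm⟩ := dif_neg hj.symm
  have hterm : ∀ a : {a // a ≠ j}, (if a = (C.merge (C.comp s) j hj.symm).comp s then 0 else
      (C.merge (C.comp s) j hj.symm).componentExcess a) =
      if a.1 = C.comp s then 0 else C.componentExcess a.1 := by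
    rintro ⟨a, ha⟩
    rw [hs]
    by_cases h : a = C.comp s
    · simp only [h, if_true]
    · have hcomp : ∀ c, (C.merge (C.comp s) j hj.symm).comp c = ⟨a, ha⟩ ↔ C.comp c = a := by
        intro c
        by_cases hc : C.comp c = j
        · simp only [hc, dite_true, Subtype.mk.injEq, Ne.symm h, Ne.symm ha]
        · simp only [hc, dite_false, Subtype.mk.injEq]
      simp only [Subtype.mk.injEq, h, if_false, componentExcess, hcomp, add_zero]
  calc (C.merge (C.comp s) j hj.symm).excess s
      = ∑ a : {a // a ≠ j}, if a.1 = C.comp s then 0 else C.componentExcess a.1 :=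
        Finset.sum_congr (Finset.ext fun _ => by simp only [Finset.mem_univ])
          fun a _ => by convert hterm a
    _ ≤ C.excess s := by
        rw [excess, Fintype.sum_eq_add_sum_subtype_ne _ j]
        exact Nat.le_add_left _ _

end Excess

/-! ### Cutting operations and their effect on the excess. -/

open Classical in
/-- Removing a handle from the component `i`. -/
abbrev removeHandle (C : Surface S) (i : C.components) : Surface S where
  components := C.components
  genus a := C.genus a - if a = i then 1 else 0
  comp := C.comp

open Classical in
/-- Cutting off the boundary circle `c` from its component, as the boundary of a disc. -/
abbrev detach (C : Surface S) (c : S) : Surface S where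
  components := Option C.components
  genus
    | none => 0
    | some a => C.genus a
  comp c' := if c' = c then none else some (C.comp c')

/-- Removing a closed component. -/
abbrev removeClosed (C : Surface S) (i : C.components) (hi : ∀ c, C.comp c ≠ i) : Surface S where
  components := {a // a ≠ i}
  fintype := Fintype.ofFinite _
  genus a := C.genus a
  comp c := ⟨C.comp c, hi c⟩

theorem handleAt_removeHandle (C : Surface S) (i : C.components) (hi : C.genus i ≠ 0) :
    ((C.removeHandle i).handleAt i).Homeo C := by
  classical
  refine ⟨Equiv.refl _, fun a => ?_, fun _ => rfl⟩
  change C.components at a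
  change C.genus a = C.genus a - (if a = i then 1 else 0) + if a = i then 1 else 0
  split_ifs with h
  · rw [h, Nat.sub_add_cancel (Nat.one_le_iff_ne_zero.2 hi)]
  · rfl

theorem tube_removeHandle (C : Surface S) (i : C.components) (hi : C.genus i ≠ 0) :
    ((C.removeHandle i).tube i i).Homeo C :=
  homeo_equivalence.trans (tube_self (C.removeHandle i) i) (C.handleAt_removeHandle i hi)

theorem tube_detach (C : Surface S) (c : S) :
    ((C.detach c).tube (some (C.comp c)) none).Homeo C := by
  classical
  refine tube_homeo_of_surjective _ C _ _ (fun a => a.elim (C.comp c) id) (fun q => ⟨some q, rfl⟩)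
    rfl ?_ (fun q => ?_) fun c' => ?_
  · rintro (_ | a) (_ | b) h
    · exact .inl rfl
    · exact .inr (.inr ⟨rfl, congrArg some h.symm⟩)
    · exact .inr (.inl ⟨congrArg some h, rfl⟩)
    · exact .inl (congrArg some h)
  · have hsum : (∑ a : Option C.components,
        if a.elim (C.comp c) id = q then (C.detach c).genus a else 0) = C.genus q := by
      rw [Fintype.sum_option]
      change (if C.comp c = q then 0 else 0) + (∑ a, if a = q then C.genus a else 0) = _
      rw [Finset.sum_ite_eq' Finset.univ q, if_pos (Finset.mem_univ q), ite_self, zero_add]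
    rw [if_neg fun h => Option.some_ne_none _ h.1, add_zero]
    exact hsum.symm
  · by_cases h : c' = c
    · simp only [h, if_true, Option.elim]
    · simp only [h, if_false, Option.elim, id]

theorem addClosed_removeClosed (C : Surface S) (i : C.components) (hi : ∀ c, C.comp c ≠ i) :
    ((C.removeClosed i hi).addClosed (C.genus i)).Homeo C := by
  classical
  refine ⟨Equiv.optionSubtypeNe i, ?_, fun c => ?_⟩
  · rintro (_ | a)
    · rfl
    · rfl
  · rfl

section Excess

variable [Fintype S]

theorem excess_removeHandle_lt (s : S) (C : Surface S) {i : C.components} (hs : i ≠ C.comp s)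
    (hi : C.genus i ≠ 0) : (C.removeHandle i).excess s < C.excess s := by
  classical
  refine Finset.sum_lt_sum (fun a _ => ?_) ⟨i, Finset.mem_univ _, ?_⟩
  · by_cases h : a = C.comp s
    · simp only [h, if_true, le_refl]
    · simp only [h, if_false]
      exact Nat.add_le_add_right (Nat.sub_le _ _) _
  · simp only [hs, if_false, componentExcess, if_true]
    omega

theorem excess_removeHandle_special (s : S) (C : Surface S) :
    (C.removeHandle (C.comp s)).excess s = C.excess s := by
  classical
  refine Finset.sum_congr rfl fun a _ => ?_
  by_cases h : a = C.comp s
  · simp only [h, if_true]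
  · simp only [h, if_false, componentExcess, Nat.sub_zero]

/-- The new disc has excess zero. The second circle `c'` ensures that the truncated subtraction in
`componentExcess` really drops by one. -/
theorem excess_detach_lt (s : S) (C : Surface S) {c c' : S} (hs : C.comp c ≠ C.comp s)
    (hne : c' ≠ c) (hc' : C.comp c' = C.comp c) : (C.detach c).excess s < C.excess s := by
  classical
  have hsc : s ≠ c := fun h => hs (by rw [h])
  have hcs : (C.detach c).comp s = some (C.comp s) := if_neg hsc
  have hfil : ∀ a, ({d | (C.detach c).comp d = some a} : Finset S) =
      ({d | C.comp d = a} : Finset S).erase c := by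
    intro a
    ext d
    by_cases hd : d = c
    · simp [hd]
    · simp [hd]
  have hnone : ({d | (C.detach c).comp d = none} : Finset S) = {c} := by
    ext d
    simp
  have hcard : 1 < Finset.card ({d | C.comp d = C.comp c} : Finset S) :=
    Finset.one_lt_card.2 ⟨c', by simp [hc'], c, by simp, hne⟩
  have h1 : (C.detach c).excess s =
      ∑ a : C.components, if a = C.comp s then 0 else
        C.genus a + ((Finset.erase {d | C.comp d = a} c).card - 1) := by
    have h0 : (C.detach c).componentExcess none = 0 := by
      unfold componentExcess
      rw [Finset.card_eq_one.2 ⟨c, by convert hnone⟩]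
    have ha : ∀ a, (C.detach c).componentExcess (some a) =
        C.genus a + ((Finset.erase {d | C.comp d = a} c).card - 1) := by
      intro a
      rw [← hfil a]
      unfold componentExcess
      congr!
    rw [excess, hcs]
    refine (Fintype.sum_option (α := C.components) _).trans ?_
    simp only [h0, ha, Option.some.injEq, ite_self, zero_add]
  rw [h1]
  refine Finset.sum_lt_sum (fun a _ => ?_) ⟨C.comp c, Finset.mem_univ _, ?_⟩
  · by_cases h : a = C.comp s
    · simp only [h, if_true, le_refl]
    · simp only [h, if_false]
      have := Finset.card_erase_le (s := ({d | C.comp d = a} : Finset S)) (a := c)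
      unfold componentExcess
      omega
  · have := Finset.card_erase_of_mem (s := ({d | C.comp d = C.comp c} : Finset S)) (a := c)
      (by simp)
    simp only [hs, if_false, componentExcess]
    omega

end Excess

end Surface

/-! ### Spanning over `ℤ[H]`. -/

section Module

variable {A : Type u} {B : Type v}

theorem MorH.of_eq_of_homeo (s : A ⊕ B) {C D : Surface (A ⊕ B)} (h : C.Homeo D) :
    MorH.of s (Cob.mk C) = MorH.of s (Cob.mk D) := by
  rw [show Cob.mk C = Cob.mk D from Quotient.sound h]

theorem MorH.X_smul_of (s : A ⊕ B) (C : Surface (A ⊕ B)) :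
    (X : ℤ[X]) • MorH.of s (Cob.mk C) = MorH.of s (Cob.mk (C.addHandle s)) := by
  unfold MorH.of
  refine (Module.AEval'.X_smul_of _ _).trans (congrArg _ ?_)
  exact congrArg (relations A B).mkQ (handleLin_single s C)

theorem MorH.of_addClosed_zero (s : A ⊕ B) (C : Surface (A ⊕ B)) :
    MorH.of s (Cob.mk (C.addClosed 0)) = 0 := by
  have : Mor.of (Cob.mk (C.addClosed 0)) = 0 :=
    (Submodule.Quotient.mk_eq_zero _).2 (Submodule.subset_span (.sphere C))
  rw [MorH.of, this, map_zero]

/-- Cutting a tube by means of the special component. -/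
theorem MorH.of_tube (s : A ⊕ B) (C : Surface (A ⊕ B)) (i j : C.components) :
    MorH.of s (Cob.mk (C.tube i j)) = MorH.of s (Cob.mk (C.tube (C.comp s) i)) +
      MorH.of s (Cob.mk (C.tube (C.comp s) j)) -
      (X : ℤ[X]) • MorH.of s (Cob.mk C) := by
  -- 4TU with the first two discs on the special component; the tube joining these two is a special
  -- handle.
  have h : Mor.of (Cob.mk (C.tube (C.comp s) (C.comp s))) + Mor.of (Cob.mk (C.tube i j)) -
      Mor.of (Cob.mk (C.tube (C.comp s) i)) - Mor.of (Cob.mk (C.tube (C.comp s) j)) = 0 :=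
    (Submodule.Quotient.mk_eq_zero _).2
      (Submodule.subset_span (.fourTube C ![C.comp s, C.comp s, i, j]))
  have e : MorH.of s (Cob.mk (C.tube (C.comp s) (C.comp s))) =
      MorH.of s (Cob.mk (C.addHandle s)) := MorH.of_eq_of_homeo s (C.tube_self (C.comp s))
  rw [MorH.X_smul_of, ← e, eq_sub_iff_add_eq,
    ← sub_eq_zero]
  simp only [MorH.of, ← map_add, ← map_sub]
  rw [← map_zero (Module.AEval'.of (H s)), ← h]
  congr 1
  abel

theorem MorH.of_mem_of_generators_mem [Finite A] [Finite B] (s : A ⊕ B)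
    (N : Submodule ℤ[X] (MorH s))
    (hN : ∀ x : Cob A B, x.IsGenerator s → MorH.of s x ∈ N) (x : Cob A B) :
    MorH.of s x ∈ N := by
  have := Fintype.ofFinite (A ⊕ B)
  suffices ∀ n (C : Surface (A ⊕ B)), C.excess s = n → MorH.of s (Cob.mk C) ∈ N by
    induction x using Quotient.ind with
    | _ C => exact this _ C rfl
  intro n
  induction n using Nat.strong_induction_on with
  | _ n ih =>
  intro C hC
  obtain ⟨g, hg⟩ : ∃ g, C.genus (C.comp s) = g := ⟨_, rfl⟩
  -- The inner induction strips handles off the special component as factors `X`, at constant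
  -- excess.
  induction g generalizing C with
  | succ g ihg =>
    have e : MorH.of s (Cob.mk ((C.removeHandle (C.comp s)).addHandle s)) =
        MorH.of s (Cob.mk C) :=
      MorH.of_eq_of_homeo s (C.handleAt_removeHandle (C.comp s) (by omega))
    rw [← e, ← MorH.X_smul_of]
    refine N.smul_mem _ (ihg _ ((C.excess_removeHandle_special s).trans hC) ?_)
    simp only [hg, if_true, Nat.add_sub_cancel]
  | zero =>
  subst hC
  -- All three terms of the cut tube have excess at most that of `D`, whatever their special genus.
  have step : ∀ (D : Surface (A ⊕ B)) (i j : D.components), i ≠ D.comp s → j ≠ D.comp s →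
      D.excess s < C.excess s → MorH.of s (Cob.mk (D.tube i j)) ∈ N := by
    intro D i j hi hj hD
    rw [MorH.of_tube]
    exact N.sub_mem (N.add_mem
      (ih _ ((D.excess_tube_special_le s hi).trans_lt hD) _ rfl)
      (ih _ ((D.excess_tube_special_le s hj).trans_lt hD) _ rfl))
      (N.smul_mem _ (ih _ hD _ rfl))
  by_cases h1 : ∃ i, i ≠ C.comp s ∧ C.genus i ≠ 0
  · obtain ⟨i, hi, h0⟩ := h1
    rw [← MorH.of_eq_of_homeo s (C.tube_removeHandle i h0)]
    exact step (C.removeHandle i) i i hi hi (C.excess_removeHandle_lt s hi h0)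
  push Not at h1
  by_cases h2 : ∃ c c', C.comp c ≠ C.comp s ∧ c' ≠ c ∧ C.comp c' = C.comp c
  · obtain ⟨c, c', hs, hne, hc⟩ := h2
    have hcs : (C.detach c).comp s = some (C.comp s) := if_neg fun h => hs (by rw [h])
    rw [← MorH.of_eq_of_homeo s (C.tube_detach c)]
    refine step _ _ _ ?_ ?_ (C.excess_detach_lt s hs hne hc)
    · rw [hcs]
      exact fun h => hs (Option.some.inj h)
    · rw [hcs]
      exact (Option.some_ne_none _).symm
  push Not at h2
  -- A closed component left at this stage is a sphere, which the excess does not see; relation S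
  -- disposes of it.
  by_cases h3 : ∃ i, i ≠ C.comp s ∧ ∀ c, C.comp c ≠ i
  · obtain ⟨i, hi, hc⟩ := h3
    rw [← MorH.of_eq_of_homeo s (C.addClosed_removeClosed i hc), h1 i hi, MorH.of_addClosed_zero]
    exact N.zero_mem
  push Not at h3
  refine hN _ ⟨hg, fun i hi => ⟨h1 i hi, ?_⟩⟩
  obtain ⟨c, rfl⟩ := h3 i hi
  refine ⟨c, rfl, fun c' hc' => ?_⟩
  by_contra hne
  exact h2 c c' hi hne hc'

/-! ### State sums on the morphism group. -/

section Functional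

variable [Fintype (A ⊕ B)] {K : Type*} [Field K] (h : K) (z : A ⊕ B → Bool → K)

/-- The normalized state sum of a cobordism. -/
def Cob.stateSum : Cob A B → K :=
  Quotient.lift (fun C => h * C.stateSum h z) fun _ _ e =>
    congrArg (h * ·) (Surface.stateSum_eq_of_homeo h z e)

-- A sphere evaluates to `h⁻¹ + (-h)⁻¹ = 0` and a torus to `1 + 1 = 2`.
variable {h} in
theorem relations_le_ker_stateSum (hh : h ≠ 0) :
    relations A B ≤ LinearMap.ker (Finsupp.linearCombination ℤ (Cob.stateSum h z)) := by
  have hs : ∀ C : Surface (A ⊕ B), Finsupp.linearCombination ℤ (Cob.stateSum h z) (single C) =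
      h * C.stateSum h z := fun C => by
    rw [single, Finsupp.linearCombination_single, one_smul]
    rfl
  refine Submodule.span_le.2 ?_
  rintro _ (C | C | ⟨C, d⟩)
  · rw [SetLike.mem_coe, LinearMap.mem_ker, hs, Surface.stateSum_addClosed]
    simp
  · rw [SetLike.mem_coe, LinearMap.mem_ker, map_sub, map_nsmul, hs, hs,
      Surface.stateSum_addClosed]
    simp only [pow_one, mul_inv_cancel₀ hh, mul_inv_cancel₀ (neg_ne_zero.2 hh), nsmul_eq_mul]
    push_cast
    ring
  · rw [SetLike.mem_coe, LinearMap.mem_ker, map_sub, map_sub, map_add, hs, hs, hs, hs]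
    linear_combination h * Surface.stateSum_fourTube z hh C d

/-- The normalized state sum on the morphism group. -/
def Mor.stateSum (hh : h ≠ 0) : Mor A B →ₗ[ℤ] K :=
  (relations A B).liftQ _ (relations_le_ker_stateSum z hh)

theorem Mor.stateSum_of (hh : h ≠ 0) (C : Surface (A ⊕ B)) :
    Mor.stateSum h z hh (Mor.of (Cob.mk C)) = h * C.stateSum h z := by
  refine (Finsupp.linearCombination_single ℤ _ _).trans ?_
  rw [one_smul]
  rfl

theorem Mor.stateSum_H (hh : h ≠ 0) {s : A ⊕ B} (hs : z s false = 0) (m : Mor A B) :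
    Mor.stateSum h z hh (H s m) = h * Mor.stateSum h z hh m := by
  obtain ⟨x, rfl⟩ := Submodule.mkQ_surjective _ m
  induction x using Finsupp.induction_linear with
  | zero => simp
  | add x y hx hy => rw [map_add, map_add, map_add, hx, hy, map_add, mul_add]
  | single x n =>
    induction x using Quotient.ind with
    | _ C =>
      have e : (relations A B).mkQ (Finsupp.single (Cob.mk C) n) = n • Mor.of (Cob.mk C) := by
        rw [Mor.of, ← map_smul, Finsupp.smul_single, smul_eq_mul, mul_one]
      have e' : H s (Mor.of (Cob.mk C)) = Mor.of (Cob.mk (C.addHandle s)) :=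
        congrArg (relations A B).mkQ (handleLin_single s C)
      change Mor.stateSum h z hh (H s ((relations A B).mkQ (Finsupp.single (Cob.mk C) n))) =
        h * Mor.stateSum h z hh ((relations A B).mkQ (Finsupp.single (Cob.mk C) n))
      rw [e, map_smul, map_smul, map_smul, e', Mor.stateSum_of, Mor.stateSum_of,
        Surface.stateSum_addHandle h z C s hs, mul_smul_comm]

/-- The normalized state sum as a `ℤ[H]`-linear map. -/
def MorH.stateSum [Algebra ℤ[X] K] (hh : algebraMap ℤ[X] K X ≠ 0) {s : A ⊕ B}
    (hs : z s false = 0) : MorH s →ₗ[ℤ[X]] K :=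
  LinearMap.ofAEval (H s) (Mor.stateSum _ z hh) fun m => by
    rw [Algebra.smul_def]
    exact Mor.stateSum_H _ z hh hs m

end Functional

/-! ### Linear independence and the basis. -/

theorem MorH.linearIndependent_generators [Finite A] [Finite B] (s : A ⊕ B) :
    LinearIndependent ℤ[X]
      fun x : {x : Cob A B // Cob.IsGenerator s x} => MorH.of s x.1 := by
  classical
  have := Fintype.ofFinite (A ⊕ B)
  -- The weights invert `h = X`, hence the fraction field; injectivity of `ℤ[X] → K` brings the
  -- vanishing of coefficients back.
  let K := FractionRing ℤ[X]
  have hinj : Function.Injective (algebraMap ℤ[X] K) := IsFractionRing.injective _ _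
  have hh : algebraMap ℤ[X] K X ≠ 0 := (map_ne_zero_iff _ hinj).2 X_ne_zero
  rw [linearIndependent_iff']
  rintro t g hg ⟨x, hx⟩ hxt
  induction x using Quotient.ind with
  | _ C =>
  have hs : s ∈ C.specialCircles s := C.mem_specialCircles_self
  let φ : MorH s →ₗ[ℤ[X]] K := MorH.stateSum
    (Surface.detector (algebraMap ℤ[X] K X) s (C.specialCircles s)) hh
    (Surface.detector_special_false hs)
  have hφ : ∀ D : Surface (A ⊕ B), φ (MorH.of s (Cob.mk D)) = algebraMap ℤ[X] K X *
      D.stateSum (algebraMap ℤ[X] K X)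
        (Surface.detector (algebraMap ℤ[X] K X) s (C.specialCircles s)) :=
    fun D => Mor.stateSum_of _ _ hh D
  have h1 : φ (MorH.of s (Cob.mk C)) = 1 :=
    (hφ C).trans (Surface.IsGenerator.stateSum_detector_self hx hh)
  have h0 := congrArg φ hg
  rw [map_sum, map_zero, Finset.sum_eq_single_of_mem _ hxt, map_smul] at h0
  · change g _ • φ (MorH.of s (Cob.mk C)) = 0 at h0
    rw [h1, Algebra.smul_def, mul_one] at h0
    exact (map_eq_zero_iff _ hinj).1 h0
  · rintro ⟨y, hy⟩ - hne
    induction y using Quotient.ind with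
    | _ D =>
    rw [map_smul]
    change g _ • φ (MorH.of s (Cob.mk D)) = 0
    rw [hφ, Surface.IsGenerator.stateSum_detector_of_ne (C := D) hy hs, mul_zero, smul_zero]
    intro e
    exact hne (Subtype.ext (Quotient.sound
      (Surface.IsGenerator.homeo_of_specialCircles_eq (C := D) (D := C) hy hx e)))

theorem MorH.span_generators [Finite A] [Finite B] (s : A ⊕ B) :
    Submodule.span ℤ[X]
      (Set.range fun x : {x : Cob A B // Cob.IsGenerator s x} => MorH.of s x.1) = ⊤ := by
  refine eq_top_iff.2 fun m _ => ?_
  obtain ⟨m, rfl⟩ := (Module.AEval'.of (H s)).surjective m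
  obtain ⟨x, rfl⟩ := Submodule.mkQ_surjective _ m
  induction x using Finsupp.induction_linear with
  | zero => simp
  | add x y hx hy =>
    rw [map_add, map_add]
    exact Submodule.add_mem _ (hx trivial) (hy trivial)
  | single x n =>
    have e : (relations A B).mkQ (Finsupp.single x n) = n • Mor.of x := by
      rw [Mor.of, ← map_smul, Finsupp.smul_single, smul_eq_mul, mul_one]
    rw [e, map_zsmul]
    exact zsmul_mem (MorH.of_mem_of_generators_mem s _
      (fun y hy => Submodule.subset_span (Set.mem_range_self
        (⟨y, hy⟩ : {x : Cob A B // Cob.IsGenerator s x}))) x) n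

end Module

end CobL

end

theorem mainTheorem1 {A B : Type*} [Finite A] [Finite B] (s : A ⊕ B) :
    ∃ b : Module.Basis {x : CobL.Cob A B // CobL.Cob.IsGenerator s x} ℤ[X] (CobL.MorH s),
      ∀ x, b x = CobL.MorH.of s x.1 :=
  ⟨Module.Basis.mk (CobL.MorH.linearIndependent_generators s)
    (CobL.MorH.span_generators s).ge, fun x => Module.Basis.mk_apply _ _ x⟩
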